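/- For a nonempty finite set $X\subseteq\{0,1\}^n$, the polytope $Q=\mathrm{conv}(X)\subseteq\mathbb{R}^n$ is called a $0/1$-polytope; its graph $G_Q=(V,E)$ is its $1$-skeleton, i.e. $V$ is the set of vertices of $Q$ and two distinct vertices are adjacent when the segment joining them is a face of $Q$. A Markov chain on $G_Q$ with transition matrix $P$ moves in each step along an edge or stays in place ($P(u,v)=0$ if $u\ne v$ and $uv\notin E$); it is reversible with respect to a distribution $\pi$ on $V$ if $\pi(u)P(u,v)=\pi(v)P(v,u)$ for all $u,v\in V$. For $\epsilon\in(0,1)$, its $\epsilon$-mixing time $\tau_{\mathrm{mix}}(P,\epsilon)\in\mathbb{N}\cup\{\infty\}$ is the least $t\in\mathbb{N}$ such that for every initial distribution $\rho$ on $V$ the distribution $\rho^{T}P^t$ is within total variation distance $\epsilon$ of $\pi$ ($\infty$ if there is no such $t$). **Corollary (Torpid Mixing to Uniform Distribution).** For every real constant $k>2$ there is a sequence of $0/1$-polytopes $Q_n\subseteq\mathbb{R}^n$, with graphs $G_{Q_n}=(V_n,E_n)$ and $|V_n|\to\infty$, such that every reversible Markov chain on $G_{Q_n}$ with uniform stationary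 distribution $\vec 1/|V_n|$ has mixing time $\Omega\big(|V_n|^{1-2/k}\big)$. That is, for every $\epsilon\in(0,1/2)$ there is $c>0$, depending only on $k$ and $\epsilon$, such that for all sufficiently large $n$ and every transition matrix $P$ of a Markov chain on $G_{Q_n}$ that is reversible with respect to $\vec 1/|V_n|$, $$\tau_{\mathrm{mix}}(P,\epsilon)\ \ge\ c\,|V_n|^{1-2/k}.$$ -/

import Mathlib

open scoped ENNReal Matrix

noncomputable section

/-- A 0/1-polytope in `ℝⁿ`, given by a nonempty finite set of 0/1-points whose convex hull it is. -/
structure ZeroOnePolytope (n : ℕ) where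
  points : Finset (Fin n → ℝ)
  points_nonempty : points.Nonempty
  zero_or_one : ∀ x ∈ points, ∀ i, x i = 0 ∨ x i = 1

namespace ZeroOnePolytope

variable {n : ℕ}

/-- The polytope itself, as a subset of `ℝⁿ`. -/
def toSet (Q : ZeroOnePolytope n) : Set (Fin n → ℝ) :=
  convexHull ℝ (Q.points : Set (Fin n → ℝ))

/-- The vertices of the polytope: the points that form a face, i.e. on which some linear functional
attains its maximum over the polytope uniquely. -/
def vertexSet (Q : ZeroOnePolytope n) : Set (Fin n → ℝ) :=
  Set.exposedPoints ℝ Q.toSet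

theorem vertexSet_subset_points (Q : ZeroOnePolytope n) :
    Q.vertexSet ⊆ (Q.points : Set (Fin n → ℝ)) :=
  exposedPoints_subset_extremePoints.trans extremePoints_convexHull_subset

abbrev Vertex (Q : ZeroOnePolytope n) : Type := ↥Q.vertexSet

instance (Q : ZeroOnePolytope n) : Fintype Q.Vertex :=
  (Q.points.finite_toSet.subset Q.vertexSet_subset_points).fintype

/-- The 1-skeleton: two distinct vertices are adjacent when the segment joining them is a face
of the polytope, i.e. the set of maximizers over the polytope of some linear functional. -/
def graph (Q : ZeroOnePolytope n) : SimpleGraph Q.Vertex where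
  Adj x y := x ≠ y ∧ IsExposed ℝ Q.toSet (segment ℝ (x : Fin n → ℝ) (y : Fin n → ℝ))
  symm := ⟨fun x y h => ⟨h.1.symm, by rw [segment_symm]; exact h.2⟩⟩
  loopless := ⟨fun _ h => h.1 rfl⟩

end ZeroOnePolytope

/-- The uniform distribution on a finite set. -/
def uniformDist (V : Type*) [Fintype V] : V → ℝ := fun _ => 1 / (Fintype.card V : ℝ)

/-- `P` is the transition matrix of a Markov chain on the graph `G` (a step follows an edge or
stays in place) that is time-reversible with respect to `π`; in particular `π` is stationary. -/
structure IsReversibleChainOn {V : Type*} [Fintype V] (G : SimpleGraph V) (π : V → ℝ)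
    (P : Matrix V V ℝ) : Prop where
  nonneg : ∀ u v, 0 ≤ P u v
  row_sum : ∀ u, ∑ v, P u v = 1
  supported : ∀ u v, u ≠ v → ¬ G.Adj u v → P u v = 0
  reversible : ∀ u v, π u * P u v = π v * P v u

/-- Total variation distance `max_S |μ(S) - ν(S)|`. -/
def tvDist {V : Type*} [Fintype V] (μ ν : V → ℝ) : ℝ :=
  ⨆ S : Finset V, |∑ v ∈ S, μ v - ∑ v ∈ S, ν v|

open Classical in
/-- The `ε`-mixing time to `π`: the least `t` such that, from every initial distribution, the
distribution after `t` steps is within total variation distance `ε` of `π` (and `⊤` if no such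
`t` exists). -/
def mixingTime {V : Type*} [Fintype V] (P : Matrix V V ℝ) (π : V → ℝ) (ε : ℝ) : ℕ∞ :=
  sInf ((fun t : ℕ => (t : ℕ∞)) ''
    {t : ℕ | ∀ ρ ∈ stdSimplex ℝ V, tvDist (ρ ᵥ* P ^ t) π ≤ ε})

end

/-! Fix an integer `j ≥ k`, so `j ≥ 3`. The polytope is the hull of all `j`-sets, all their
complements, and a set `S` of only `O(n ^ 2)` further 0/1-points, chosen so that outside `S` no
`j`-set is adjacent to a complement. Then `S` is a vertex cut between two sides, each with nearly
half of the `|V| ≈ 2 * n.choose j` vertices.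

Existence of `S`: a functional exposing an edge from `a` to `bᶜ` takes equal values at both ends.
Reflecting the cube face spanned by `a` and `bᶜ` in its centre shows that at least half of the face
has value at least this large, a constant fraction of the cube. By Radon and Sauer–Shelah there are
only `2 ^ O(n ^ 2)` such sets, so a greedy choice hits all of them with `O(n ^ 2)` points. A hit
inside the exposed face contradicts adjacency (`not_adj_of_separating`).

Mixing: reversibility for the uniform distribution makes `P` symmetric, so a start uniform on one
side keeps density at most `1 / |A|` and at most `|S| / |A|` mass crosses per step. Hence the time
is of order at least `|V| / n ^ 2`, and `n ^ 2 = O(|V| ^ (2 / k))`. -/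

/-! ### Small hitting sets -/

/-- If every member of a family of at most `2 ^ q` sets has density at least `1 / K`, then some set
of at most `K * (q + 1)` points meets all of them. -/
theorem exists_small_hitting_set {Ω : Type*} [Fintype Ω] [DecidableEq Ω] (K : ℕ)
    (F : Finset (Finset Ω)) (q : ℕ) (hF : F.card ≤ 2 ^ q)
    (hK : ∀ D ∈ F, D.Nonempty ∧ Fintype.card Ω ≤ K * D.card) :
    ∃ S : Finset Ω, S.card ≤ K * (q + 1) ∧ ∀ D ∈ F, ∃ x ∈ S, x ∈ D := by
  have greedy : ∀ t : ℕ, ∃ S : Finset Ω, S.card ≤ t ∧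
      ((F.filter fun D => ∀ x ∈ S, x ∉ D).card : ℝ) ≤ (1 - 1 / (K : ℝ)) ^ t * F.card := by
    intro t
    induction t with
    | zero => exact ⟨∅, by simp, by simp⟩
    | succ t ih =>
      obtain ⟨S, hS, hcard⟩ := ih
      set F' := F.filter fun D => ∀ x ∈ S, x ∉ D with hF'
      rcases F'.eq_empty_or_nonempty with he | hne
      · refine ⟨S, by omega, ?_⟩
        rw [← hF', he]
        rcases Nat.eq_zero_or_pos K with h0 | h0
        · simp [h0]
        · have : (1 : ℝ) / K ≤ 1 := by
            rw [div_le_one (by positivity)]; exact_mod_cast h0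
          have : (0 : ℝ) ≤ 1 - 1 / K := by linarith
          simp only [Finset.card_empty, Nat.cast_zero]
          positivity
      · obtain ⟨D₀, hD₀⟩ := hne
        have hmem : ∀ D ∈ F', D ∈ F := fun D h => (Finset.mem_filter.1 h).1
        obtain ⟨⟨x₀, -⟩, hx₀⟩ := hK D₀ (hmem _ hD₀)
        have hΩ : 0 < Fintype.card Ω := Fintype.card_pos_iff.2 ⟨x₀⟩
        have hKpos : 0 < K := by
          rcases Nat.eq_zero_or_pos K with h0 | h0
          · simp [h0] at hx₀; omega
          · exact h0
        have hdc : ∑ x : Ω, (F'.filter fun D => x ∈ D).card = ∑ D ∈ F', D.card := by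
          have h := Finset.sum_card_bipartiteAbove_eq_sum_card_bipartiteBelow
            (s := (Finset.univ : Finset Ω)) (t := F') fun x D => x ∈ D
          simpa [Finset.bipartiteAbove, Finset.bipartiteBelow] using h
        -- Double counting: an average point lies in at least a `1 / K` fraction of the sets not yet
        -- hit.
        obtain ⟨x, hx⟩ : ∃ x : Ω, F'.card ≤ K * (F'.filter fun D => x ∈ D).card := by
          by_contra! hcon
          have h1 : ∑ x : Ω, K * (F'.filter fun D => x ∈ D).card < ∑ x : Ω, F'.card :=
            Finset.sum_lt_sum_of_nonempty ⟨x₀, Finset.mem_univ _⟩ fun x _ => hcon x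
          rw [← Finset.mul_sum, hdc, Finset.sum_const, Finset.card_univ, smul_eq_mul,
            Finset.mul_sum] at h1
          have h2 : ∑ D ∈ F', Fintype.card Ω ≤ ∑ D ∈ F', K * D.card :=
            Finset.sum_le_sum fun D hD => (hK D (hmem D hD)).2
          rw [Finset.sum_const, smul_eq_mul] at h2
          nlinarith
        refine ⟨insert x S, (Finset.card_insert_le _ _).trans (by omega), ?_⟩
        have hsub : (F.filter fun D => ∀ y ∈ insert x S, y ∉ D) = F'.filter fun D => x ∉ D := by
          ext D; simp only [hF', Finset.mem_filter, Finset.forall_mem_insert]; tauto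
        have hsplit := Finset.card_filter_add_card_filter_not (s := F') (fun D => x ∈ D)
        rw [hsub]
        have hsplit' : ((F'.filter fun D => x ∈ D).card : ℝ) + (F'.filter fun D => x ∉ D).card
          = F'.card := by exact_mod_cast hsplit
        have hx' : (F'.card : ℝ) ≤ K * (F'.filter fun D => x ∈ D).card := by exact_mod_cast hx
        have hKr : (0 : ℝ) < K := by exact_mod_cast hKpos
        have h3 : (F'.card : ℝ) / K ≤ (F'.filter fun D => x ∈ D).card := by
          rw [div_le_iff₀ hKr]; linarith
        have hle1 : (1 : ℝ) / K ≤ 1 := by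
          rw [div_le_one hKr]; exact_mod_cast hKpos
        calc ((F'.filter fun D => x ∉ D).card : ℝ) ≤ (1 - 1 / K) * F'.card := by
              have : (1 - 1 / (K : ℝ)) * F'.card = F'.card - F'.card / K := by ring
              linarith
          _ ≤ (1 - 1 / K) * ((1 - 1 / (K : ℝ)) ^ t * F.card) :=
              mul_le_mul_of_nonneg_left hcard (by linarith)
          _ = _ := by ring
  rcases F.eq_empty_or_nonempty with he | ⟨D₀, hD₀⟩
  · exact ⟨∅, by simp, by simp [he]⟩
  have hKpos : 0 < K := by
    obtain ⟨⟨x₀, -⟩, hx₀⟩ := hK D₀ hD₀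
    have hΩ : 0 < Fintype.card Ω := Fintype.card_pos_iff.2 ⟨x₀⟩
    exact Nat.pos_of_mul_pos_right (lt_of_lt_of_le hΩ hx₀)
  have hKr : (0 : ℝ) < K := by exact_mod_cast hKpos
  -- Every `K` rounds at least halve the unhit sets, so `q + 1` such blocks bring `2 ^ q` below one.
  obtain ⟨S, hS, hcard⟩ := greedy (K * (q + 1))
  refine ⟨S, hS, ?_⟩
  have hhalf : (1 - 1 / (K : ℝ)) ^ K ≤ 1 / 2 := by
    have h1 : (1 - 1 / (K : ℝ)) ^ K ≤ Real.exp (-1) := by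
      have h2 := Real.one_sub_div_pow_le_exp_neg (n := K) (t := 1) (by exact_mod_cast hKpos)
      exact h2
    have h3 : Real.exp (-1) ≤ 1 / 2 := by
      rw [Real.exp_neg, inv_le_comm₀ (Real.exp_pos _) (by norm_num)]
      have := Real.add_one_le_exp (1 : ℝ)
      norm_num at this ⊢
      linarith
    exact h1.trans h3
  have hle1 : (1 : ℝ) / K ≤ 1 := by
    rw [div_le_one hKr]; exact_mod_cast hKpos
  have hlt : ((F.filter fun D => ∀ x ∈ S, x ∉ D).card : ℝ) < 1 := by
    calc _ ≤ (1 - 1 / (K : ℝ)) ^ (K * (q + 1)) * F.card := hcard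
      _ ≤ (1 / 2) ^ (q + 1) * 2 ^ q := by
          rw [pow_mul]
          exact mul_le_mul (pow_le_pow_left₀ (pow_nonneg (sub_nonneg.2 hle1) _) hhalf _)
            (by exact_mod_cast hF) (by positivity) (by positivity)
      _ < 1 := by
          rw [pow_succ, mul_right_comm, ← mul_pow]; norm_num
  have h0 : (F.filter fun D => ∀ x ∈ S, x ∉ D).card = 0 := by
    have : (F.filter fun D => ∀ x ∈ S, x ∉ D).card < 1 := by exact_mod_cast hlt
    omega
  rw [Finset.card_eq_zero, Finset.filter_eq_empty_iff] at h0
  intro D hD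
  simpa using h0 hD

/-! ### Counting halfspaces of the cube -/

open Classical in
/-- The traces on the cube (points identified with subsets of `Fin n`) of the closed
halfspaces. -/
noncomputable def halfspaceTraces (n : ℕ) : Finset (Finset (Finset (Fin n))) :=
  Finset.univ.filter fun H =>
    ∃ (c : Fin n → ℝ) (θ : ℝ), H = Finset.univ.filter fun y => θ ≤ ∑ i ∈ y, c i

theorem sum_indicator_mul {n : ℕ} (c : Fin n → ℝ) (s : Finset (Fin n)) :
    ∑ i, c i * (if i ∈ s then (1 : ℝ) else 0) = ∑ i ∈ s, c i := by
  simp [Finset.sum_ite_mem]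

/-- More than `n + 1` points have a Radon partition; a halfspace cutting out one part would both
contain and miss the common point of the two hulls. -/
theorem card_le_of_shatters_halfspaceTraces {n : ℕ} {s : Finset (Finset (Fin n))}
    (hs : (halfspaceTraces n).Shatters s) : s.card ≤ n + 1 := by
  classical
  by_contra! hcard
  let f : s → Fin n → ℝ := fun y i => if i ∈ y.1 then 1 else 0
  have hdep : ¬ AffineIndependent ℝ f := by
    intro h
    have h1 := h.card_le_finrank_succ
    have h2 := Submodule.finrank_le (vectorSpan ℝ (Set.range f))
    simp only [Module.finrank_fintype_fun_eq_card, Fintype.card_fin, Fintype.card_coe] at h1 h2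
    omega
  obtain ⟨I, p, hp, hp'⟩ := Convex.radon_partition hdep
  obtain ⟨H, hH, hHs⟩ := hs (t := s.filter fun y => ∃ h : y ∈ s, (⟨y, h⟩ : s) ∈ I)
    (Finset.filter_subset _ _)
  obtain ⟨c, θ, rfl⟩ := (Finset.mem_filter.1 hH).2
  have key : ∀ y : s, θ ≤ ∑ i ∈ y.1, c i ↔ y ∈ I := by
    intro y
    have h1 := congrArg (fun t => y.1 ∈ t) hHs
    simpa using h1
  have hlin : IsLinearMap ℝ fun x : Fin n → ℝ => ∑ i, c i * x i :=
    { map_add := fun x y => by simp [mul_add, Finset.sum_add_distrib]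
      map_smul := fun a x => by
        simp only [Pi.smul_apply, smul_eq_mul, Finset.mul_sum]
        exact Finset.sum_congr rfl fun i _ => by ring }
  have h1 : p ∈ {x : Fin n → ℝ | θ ≤ ∑ i, c i * x i} := by
    refine convexHull_min ?_ (convex_halfSpace_ge hlin θ) hp
    rintro _ ⟨y, hy, rfl⟩
    simp only [Set.mem_ofPred_eq, f, sum_indicator_mul]
    exact (key y).2 hy
  have h2 : p ∈ {x : Fin n → ℝ | ∑ i, c i * x i < θ} := by
    refine convexHull_min ?_ (convex_halfSpace_lt hlin θ) hp'
    rintro _ ⟨y, hy, rfl⟩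
    simp only [Set.mem_ofPred_eq, f, sum_indicator_mul]
    exact lt_of_not_ge fun h => hy ((key y).1 h)
  exact (not_le.2 (Set.mem_ofPred_eq ▸ h2)) h1

/-- Sauer–Shelah with VC dimension at most `n + 1`, bounded crudely: only the order `n ^ 2` of the
exponent matters. -/
theorem card_halfspaceTraces_le (n : ℕ) :
    (halfspaceTraces n).card ≤ 2 ^ (n * (n + 1) + n + 2) := by
  have hvc : (halfspaceTraces n).vcDim ≤ n + 1 :=
    Finset.sup_le fun s hs => card_le_of_shatters_halfspaceTraces (Finset.mem_shatterer.1 hs)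
  calc (halfspaceTraces n).card ≤ _ := Finset.card_le_card_shatterer _
    _ ≤ _ := Finset.card_shatterer_le_sum_vcDim
    _ ≤ ∑ i ∈ Finset.Iic (n + 1), (2 ^ n) ^ (n + 1) := by
        refine (Finset.sum_le_sum_of_subset (Finset.Iic_subset_Iic.2 hvc)).trans
          (Finset.sum_le_sum fun i hi => ?_)
        rw [Fintype.card_finset, Fintype.card_fin]
        exact (Nat.choose_le_pow _ _).trans
          (Nat.pow_le_pow_right (by positivity) (Finset.mem_Iic.1 hi))
    _ = (n + 2) * 2 ^ (n * (n + 1)) := by simp [pow_mul]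
    _ ≤ 2 ^ (n + 2) * 2 ^ (n * (n + 1)) := Nat.mul_le_mul_right _ (Nat.lt_two_pow_self).le
    _ = _ := by rw [← pow_add]; congr 1; ring

/-! ### Separating points -/

/-- If a linear functional takes the same value on `a` and on the complement of `b`, then at least
a `2 ^ (-2 j - 1)` fraction of the cube lies in the face spanned by these two points and in the
halfspace where the functional is at least this value. -/
theorem card_le_mul_card_face_halfspace {n j : ℕ} {a b : Finset (Fin n)} (ha : a.card = j)
    (hb : b.card = j) (c : Fin n → ℝ) (hc : ∑ i ∈ a, c i = ∑ i ∈ bᶜ, c i) :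
    Fintype.card (Finset (Fin n)) ≤ 2 ^ (2 * j + 1) *
      ((Finset.Icc (a \ b) (b \ a)ᶜ).filter fun y => ∑ i ∈ a, c i ≤ ∑ i ∈ y, c i).card := by
  set E := Finset.Icc (a \ b) (b \ a)ᶜ with hE
  set D := E.filter fun y => ∑ i ∈ a, c i ≤ ∑ i ∈ y, c i with hD
  have hle : a \ b ⊆ (b \ a)ᶜ := by
    intro x; simp only [Finset.mem_sdiff, Finset.mem_compl]; tauto
  -- The reflection of the face in its centre: it swaps `a` and `bᶜ`, so the values at `y` and `φ y`
  -- average to the value at `a`.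
  let φ : Finset (Fin n) → Finset (Fin n) := fun y => (a \ b) ∪ ((b \ a)ᶜ \ y)
  have hφE : ∀ y ∈ E, φ y ∈ E := by
    intro y hy
    rw [hE, Finset.mem_Icc] at hy ⊢
    exact ⟨Finset.subset_union_left, Finset.union_subset hle Finset.sdiff_subset⟩
  have hφφ : ∀ y ∈ E, φ (φ y) = y := by
    intro y hy
    rw [hE, Finset.mem_Icc] at hy
    ext x
    have h1 := @hy.1 x
    have h2 := @hy.2 x
    simp only [φ, Finset.mem_union, Finset.mem_sdiff, Finset.mem_compl] at h1 h2 ⊢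
    tauto
  have hsum : ∀ y ∈ E, ∑ i ∈ y, c i + ∑ i ∈ φ y, c i = ∑ i ∈ a, c i + ∑ i ∈ bᶜ, c i := by
    intro y hy
    rw [hE, Finset.mem_Icc] at hy
    rw [← sum_indicator_mul c y, ← sum_indicator_mul c (φ y), ← sum_indicator_mul c a,
      ← sum_indicator_mul c bᶜ]
    rw [← Finset.sum_add_distrib, ← Finset.sum_add_distrib]
    refine Finset.sum_congr rfl fun x _ => ?_
    rw [← mul_add, ← mul_add]
    congr 1
    have h1 := @hy.1 x
    have h2 := @hy.2 x
    simp only [φ, Finset.mem_union, Finset.mem_sdiff, Finset.mem_compl] at h1 h2 ⊢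
    by_cases hxa : x ∈ a <;> by_cases hxb : x ∈ b <;> by_cases hxy : x ∈ y <;> simp_all
  have hcover : E ⊆ D ∪ D.image φ := by
    intro y hy
    by_cases h : ∑ i ∈ a, c i ≤ ∑ i ∈ y, c i
    · exact Finset.mem_union_left _ (Finset.mem_filter.2 ⟨hy, h⟩)
    · refine Finset.mem_union_right _ (Finset.mem_image.2 ⟨φ y, ?_, hφφ y hy⟩)
      refine Finset.mem_filter.2 ⟨hφE y hy, ?_⟩
      have := hsum y hy
      linarith
  have h2D : E.card ≤ 2 * D.card := by
    have h1 := (Finset.card_le_card hcover).trans (Finset.card_union_le _ _)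
    have h2 := Finset.card_image_le (s := D) (f := φ)
    omega
  -- At most `2 * j` coordinates, those in `a \ b` or `b \ a`, are fixed on the face.
  have hEcard : 2 ^ n ≤ 2 ^ (2 * j) * E.card := by
    rw [hE, Finset.card_Icc_finset hle, ← pow_add]
    refine Nat.pow_le_pow_right (by norm_num) ?_
    have h1 := Finset.card_compl (b \ a)
    have h2 := Finset.card_le_card (Finset.sdiff_subset (s := a) (t := b))
    have h3 := Finset.card_le_card (Finset.sdiff_subset (s := b) (t := a))
    rw [Fintype.card_fin] at h1
    omega
  rw [Fintype.card_finset, Fintype.card_fin]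
  calc 2 ^ n ≤ 2 ^ (2 * j) * E.card := hEcard
    _ ≤ 2 ^ (2 * j) * (2 * D.card) := Nat.mul_le_mul_left _ h2D
    _ = _ := by ring

/-- There is a set `S` of `O(n ^ 2)` points of the cube such that a linear functional with equal
values on a `j`-set `a` and on the complement of a `j`-set `b` is at least this value somewhere
on `S` inside the face spanned by them. -/
theorem exists_separating_points (n j : ℕ) :
    ∃ S : Finset (Finset (Fin n)), S.Nonempty ∧
      S.card ≤ 2 ^ (2 * j + 1) * (8 * (n + 1) ^ 2) ∧
      ∀ a b : Finset (Fin n), a.card = j → b.card = j → ∀ c : Fin n → ℝ,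
        ∑ i ∈ a, c i = ∑ i ∈ bᶜ, c i → ∃ s ∈ S, ∑ i ∈ a, c i ≤ ∑ i ∈ s, c i := by
  classical
  let G : Finset (Finset (Finset (Fin n))) :=
    ((Finset.univ ×ˢ Finset.univ) ×ˢ halfspaceTraces n).image
      fun p : (Finset (Fin n) × Finset (Fin n)) × Finset (Finset (Fin n)) =>
        Finset.Icc (p.1.1 \ p.1.2) (p.1.2 \ p.1.1)ᶜ ∩ p.2
  let F := G.filter fun D =>
    D.Nonempty ∧ Fintype.card (Finset (Fin n)) ≤ 2 ^ (2 * j + 1) * D.card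
  have hF : F.card ≤ 2 ^ (n + n + (n * (n + 1) + n + 2)) := by
    refine (Finset.card_filter_le _ _).trans (Finset.card_image_le.trans ?_)
    rw [Finset.card_product, Finset.card_product, Finset.card_univ, Fintype.card_finset,
      Fintype.card_fin, pow_add, pow_add 2 n n]
    exact Nat.mul_le_mul_left _ (card_halfspaceTraces_le n)
  obtain ⟨S, hS, hit⟩ := exists_small_hitting_set (2 ^ (2 * j + 1)) F _ hF
    fun D hD => (Finset.mem_filter.1 hD).2
  -- Adding `∅` keeps the polytope nonempty even when there are no `j`-sets.
  refine ⟨insert ∅ S, Finset.insert_nonempty _ _, ?_, ?_⟩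
  · refine (Finset.card_insert_le _ _).trans ?_
    have h1 : 1 ≤ 2 ^ (2 * j + 1) := Nat.one_le_two_pow
    calc S.card + 1 ≤ 2 ^ (2 * j + 1) * (n + n + (n * (n + 1) + n + 2) + 1)
          + 2 ^ (2 * j + 1) := by omega
      _ = 2 ^ (2 * j + 1) * (n + n + (n * (n + 1) + n + 2) + 2) := by ring
      _ ≤ _ := Nat.mul_le_mul_left _ (by nlinarith)
  · intro a b ha hb c hc
    set D := (Finset.Icc (a \ b) (b \ a)ᶜ).filter fun y => ∑ i ∈ a, c i ≤ ∑ i ∈ y, c i with hD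
    have hcard := card_le_mul_card_face_halfspace ha hb c hc
    have hDG : D ∈ G := by
      refine Finset.mem_image.2
        ⟨((a, b), Finset.univ.filter fun y => ∑ i ∈ a, c i ≤ ∑ i ∈ y, c i), ?_, ?_⟩
      · simp only [Finset.mem_product, Finset.mem_univ, true_and, halfspaceTraces,
          Finset.mem_filter]
        exact ⟨c, _, rfl⟩
      · ext y
        simp [hD]
    have hDne : D.Nonempty := by
      rw [← Finset.card_pos]
      refine Nat.pos_of_mul_pos_left (lt_of_lt_of_le ?_ hcard)
      exact Fintype.card_pos
    obtain ⟨s, hs, hsD⟩ := hit D (Finset.mem_filter.2 ⟨hDG, hDne, hcard⟩)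
    exact ⟨s, Finset.mem_insert_of_mem hs, (Finset.mem_filter.1 hsD).2⟩

/-! ### Vertex cuts and mixing time -/

theorem sub_le_tvDist {V : Type*} [Fintype V] (μ ν : V → ℝ) (S : Finset V) :
    ∑ v ∈ S, ν v - ∑ v ∈ S, μ v ≤ tvDist μ ν := by
  refine le_trans ?_ (le_ciSup (f := fun S : Finset V => |∑ v ∈ S, μ v - ∑ v ∈ S, ν v|)
    (Set.finite_range _).bddAbove S)
  rw [← neg_sub]
  exact neg_le_abs _

open Classical in
/-- A vertex cut bounds the time that a symmetric chain needs to get close to uniform: if the chain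
can enter `B` only from `S`, then started uniformly on `A` it has moved at most `t |S| / |A|` mass
to `B` after `t` steps. -/
theorem mul_card_le_of_tvDist_le {V : Type*} [Fintype V] {P : Matrix V V ℝ}
    (hnn : ∀ u v, 0 ≤ P u v) (hrow : ∀ u, ∑ v, P u v = 1) (hsymm : ∀ u v, P u v = P v u)
    {A S B : Finset V} (hA : A.Nonempty) (hAB : Disjoint A B)
    (hcut : ∀ u v, u ∉ S → u ∉ B → v ∈ B → P u v = 0) {ε : ℝ} {t : ℕ}
    (hmix : ∀ ρ ∈ stdSimplex ℝ V, tvDist (ρ ᵥ* P ^ t) (uniformDist V) ≤ ε) :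
    ((B.card : ℝ) / Fintype.card V - ε) * A.card ≤ t * S.card := by
  have hApos : (0 : ℝ) < A.card := by exact_mod_cast hA.card_pos
  let ρ : V → ℝ := fun v => if v ∈ A then 1 / A.card else 0
  have hcol : ∀ v, ∑ u, P u v = 1 := fun v => by
    rw [← hrow v]; exact Finset.sum_congr rfl fun u _ => hsymm u v
  have hρ : ρ ∈ stdSimplex ℝ V := by
    refine ⟨fun v => ?_, ?_⟩
    · simp only [ρ]; split_ifs <;> positivity
    · simp only [ρ, Finset.sum_ite_mem, Finset.univ_inter, Finset.sum_const, nsmul_eq_mul]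
      field_simp
  have hstep : ∀ (s : ℕ) (v : V), (ρ ᵥ* P ^ (s + 1)) v = ∑ u, (ρ ᵥ* P ^ s) u * P u v := by
    intro s v
    rw [pow_succ, ← Matrix.vecMul_vecMul]
    rfl
  -- Columns of `P` sum to one, so the initial pointwise bound persists.
  have hbound : ∀ (s : ℕ) (v : V), 0 ≤ (ρ ᵥ* P ^ s) v ∧ (ρ ᵥ* P ^ s) v ≤ 1 / A.card := by
    intro s
    induction s with
    | zero =>
      intro v
      simp only [pow_zero, Matrix.vecMul_one, ρ]
      split_ifs
      · exact ⟨by positivity, le_rfl⟩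
      · exact ⟨le_rfl, by positivity⟩
    | succ s ih =>
      intro v
      rw [hstep]
      refine ⟨Finset.sum_nonneg fun u _ => mul_nonneg (ih u).1 (hnn u v), ?_⟩
      calc ∑ u, (ρ ᵥ* P ^ s) u * P u v ≤ ∑ u, 1 / (A.card : ℝ) * P u v :=
            Finset.sum_le_sum fun u _ => mul_le_mul_of_nonneg_right (ih u).2 (hnn u v)
        _ = 1 / A.card := by rw [← Finset.mul_sum, hcol, mul_one]
  have hmass : ∀ s : ℕ, ∑ v ∈ B, (ρ ᵥ* P ^ s) v ≤ s * S.card / A.card := by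
    intro s
    induction s with
    | zero =>
      have : ∑ v ∈ B, (ρ ᵥ* P ^ 0) v = 0 := by
        refine Finset.sum_eq_zero fun v hv => ?_
        simp only [pow_zero, Matrix.vecMul_one, ρ]
        rw [if_neg (Finset.disjoint_right.1 hAB hv)]
      rw [this]; simp
    | succ s ih =>
      have hin : ∀ u, ∑ v ∈ B, P u v ≤ 1 := fun u => by
        rw [← hrow u]
        exact Finset.sum_le_sum_of_subset_of_nonneg (Finset.subset_univ _) fun v _ _ => hnn u v
      calc ∑ v ∈ B, (ρ ᵥ* P ^ (s + 1)) v
          = ∑ u, (ρ ᵥ* P ^ s) u * ∑ v ∈ B, P u v := by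
            simp only [hstep, Finset.mul_sum]
            exact Finset.sum_comm
        _ = ∑ u ∈ B ∪ S, (ρ ᵥ* P ^ s) u * ∑ v ∈ B, P u v := by
            refine (Finset.sum_subset (Finset.subset_univ _) fun u _ hu => ?_).symm
            rw [Finset.mem_union, not_or] at hu
            rw [Finset.sum_eq_zero fun v hv => hcut u v hu.2 hu.1 hv, mul_zero]
        _ ≤ ∑ u ∈ B ∪ S, (ρ ᵥ* P ^ s) u :=
            Finset.sum_le_sum fun u _ => mul_le_of_le_one_right (hbound s u).1 (hin u)
        _ ≤ ∑ u ∈ B, (ρ ᵥ* P ^ s) u + ∑ u ∈ S, (ρ ᵥ* P ^ s) u := by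
            rw [← Finset.sum_union_inter]
            exact le_add_of_nonneg_right (Finset.sum_nonneg fun u _ => (hbound s u).1)
        _ ≤ s * S.card / A.card + ∑ u ∈ S, 1 / (A.card : ℝ) :=
            add_le_add ih (Finset.sum_le_sum fun u _ => (hbound s u).2)
        _ = _ := by
            rw [Finset.sum_const, nsmul_eq_mul]; push_cast; ring
  have h1 := (sub_le_tvDist (ρ ᵥ* P ^ t) (uniformDist V) B).trans (hmix ρ hρ)
  have h2 := hmass t
  have h3 : ∑ v ∈ B, uniformDist V v = (B.card : ℝ) / Fintype.card V := by
    simp [uniformDist, div_eq_mul_inv]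
  rw [h3] at h1
  rw [← le_div_iff₀ hApos]
  linarith

open Classical in
theorem ofReal_le_mixingTime {V : Type*} [Fintype V] {P : Matrix V V ℝ} {π : V → ℝ} {ε x : ℝ}
    (h : ∀ t : ℕ, (∀ ρ ∈ stdSimplex ℝ V, tvDist (ρ ᵥ* P ^ t) π ≤ ε) → x ≤ t) :
    ENNReal.ofReal x ≤ (mixingTime P π ε : ℝ≥0∞) := by
  unfold mixingTime
  rcases Set.eq_empty_or_nonempty ((fun t : ℕ => (t : ℕ∞)) ''
    {t : ℕ | ∀ ρ ∈ stdSimplex ℝ V, tvDist (ρ ᵥ* P ^ t) π ≤ ε}) with he | hne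
  · rw [he, sInf_empty]
    simp
  · obtain ⟨t, ht, hteq⟩ := csInf_mem hne
    rw [← hteq]
    simpa using ENNReal.ofReal_le_ofReal (h t ht)

/-! ### Vertices and edges of 0/1-polytopes -/

/-- The 0/1-point with a given support. -/
def zeroOnePoint {n : ℕ} (s : Finset (Fin n)) : Fin n → ℝ := fun i => if i ∈ s then 1 else 0

theorem zeroOnePoint_injective {n : ℕ} :
    Function.Injective (zeroOnePoint : Finset (Fin n) → Fin n → ℝ) := by
  intro s t h
  ext i
  have := congrFun h i
  by_cases hs : i ∈ s <;> by_cases ht : i ∈ t <;> simp_all [zeroOnePoint]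

/-- The 0/1-polytope whose points have the given supports. -/
noncomputable def polytopeOfSupports {n : ℕ} (X : Finset (Finset (Fin n))) (hX : X.Nonempty) :
    ZeroOnePolytope n where
  points := X.map ⟨zeroOnePoint, zeroOnePoint_injective⟩
  points_nonempty := hX.map
  zero_or_one := by
    intro x hx i
    obtain ⟨s, -, rfl⟩ := Finset.mem_map.1 hx
    by_cases h : i ∈ s <;> simp [zeroOnePoint, h]

theorem clm_zeroOnePoint {n : ℕ} (l : StrongDual ℝ (Fin n → ℝ)) (s : Finset (Fin n)) :
    l (zeroOnePoint s) = ∑ i ∈ s, l (Pi.single i 1) := by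
  rw [← map_sum]
  congr 1
  ext j
  simp [zeroOnePoint, Finset.sum_apply, Pi.single_apply]

/-- The functional with coefficients `2 * x i - 1 = ±1` is maximized over the unit cube only at `x`.
-/
theorem mem_exposedPoints_of_zero_or_one {n : ℕ} {C : Set (Fin n → ℝ)}
    (hC : C ⊆ Set.Icc 0 1) {x : Fin n → ℝ} (hx : x ∈ C) (h01 : ∀ i, x i = 0 ∨ x i = 1) :
    x ∈ C.exposedPoints ℝ := by
  let l : StrongDual ℝ (Fin n → ℝ) :=
    ∑ i, (2 * x i - 1) • ContinuousLinearMap.proj (R := ℝ) (φ := fun _ : Fin n => ℝ) i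
  have hl : ∀ y, l y = ∑ i, (2 * x i - 1) * y i := fun y => by
    simp [l]
  have hterm : ∀ y ∈ C, ∀ i, (2 * x i - 1) * y i ≤ (2 * x i - 1) * x i := by
    intro y hy i
    have h0 := (hC hy).1 i
    have h1 := (hC hy).2 i
    simp only [Pi.zero_apply, Pi.one_apply] at h0 h1
    rcases h01 i with h | h <;> rw [h] <;> linarith
  refine ⟨hx, l, fun y hy => ⟨?_, fun hle => ?_⟩⟩
  · rw [hl, hl]
    exact Finset.sum_le_sum fun i _ => hterm y hy i
  · rw [hl, hl] at hle
    have heq := (Finset.sum_eq_sum_iff_of_le fun i _ => hterm y hy i).1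
      (le_antisymm (Finset.sum_le_sum fun i _ => hterm y hy i) hle)
    ext i
    have hi := heq i (Finset.mem_univ i)
    rcases h01 i with h | h <;> rw [h] at hi ⊢ <;> linarith

theorem vertexSet_polytopeOfSupports {n : ℕ} (X : Finset (Finset (Fin n))) (hX : X.Nonempty) :
    (polytopeOfSupports X hX).vertexSet = zeroOnePoint '' (X : Set (Finset (Fin n))) := by
  have hpts : ((polytopeOfSupports X hX).points : Set (Fin n → ℝ)) =
      zeroOnePoint '' (X : Set (Finset (Fin n))) := by
    simp [polytopeOfSupports]
  refine Set.Subset.antisymm ?_ ?_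
  · rw [← hpts]
    exact (polytopeOfSupports X hX).vertexSet_subset_points
  · intro x hx
    rw [← hpts] at hx
    have h01 := (polytopeOfSupports X hX).zero_or_one
    refine mem_exposedPoints_of_zero_or_one ?_ (subset_convexHull ℝ _ hx) (h01 x hx)
    refine convexHull_min (fun y hy => ?_) (convex_Icc 0 1)
    refine ⟨fun i => ?_, fun i => ?_⟩ <;> rcases h01 y hy i with h | h <;> rw [h] <;> simp

/-- The vertices are in bijection with the supports. -/
noncomputable def supportsEquivVertex {n : ℕ} (X : Finset (Finset (Fin n))) (hX : X.Nonempty) :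
    X ≃ (polytopeOfSupports X hX).Vertex :=
  (Equiv.Set.image zeroOnePoint (X : Set (Finset (Fin n))) zeroOnePoint_injective).trans
    (Equiv.setCongr (vertexSet_polytopeOfSupports X hX).symm)

theorem coe_supportsEquivVertex {n : ℕ} {X : Finset (Finset (Fin n))} {hX : X.Nonempty} (s : X) :
    ((supportsEquivVertex X hX s : (polytopeOfSupports X hX).Vertex) : Fin n → ℝ) =
      zeroOnePoint s.1 := rfl

/-- The only 0/1-points on the segment between two 0/1-points are its ends. -/
theorem eq_or_eq_of_zeroOnePoint_mem_segment {n : ℕ} {s a b : Finset (Fin n)}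
    (h : zeroOnePoint s ∈ segment ℝ (zeroOnePoint a) (zeroOnePoint b)) : s = a ∨ s = b := by
  have hext : zeroOnePoint s ∈ (Set.Icc (0 : Fin n → ℝ) 1).extremePoints ℝ := by
    refine exposedPoints_subset_extremePoints (mem_exposedPoints_of_zero_or_one le_rfl ?_ ?_)
    · refine ⟨fun i => ?_, fun i => ?_⟩ <;> by_cases hi : i ∈ s <;> simp [zeroOnePoint, hi]
    · intro i; by_cases hi : i ∈ s <;> simp [zeroOnePoint, hi]
  have hmem : ∀ t : Finset (Fin n), zeroOnePoint t ∈ Set.Icc (0 : Fin n → ℝ) 1 := by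
    intro t
    refine ⟨fun i => ?_, fun i => ?_⟩ <;> by_cases hi : i ∈ t <;> simp [zeroOnePoint, hi]
  rcases (mem_extremePoints_iff_forall_segment.1 hext).2 _ (hmem a) _ (hmem b) h with h | h
  · exact Or.inl (zeroOnePoint_injective h.symm)
  · exact Or.inr (zeroOnePoint_injective h.symm)

/-- If the segment were a face, `s` would also maximize the exposing functional, hence lie on the
segment and be one of its ends, which are not in `S`. -/
theorem not_adj_of_separating {n : ℕ} {X : Finset (Finset (Fin n))} {hX : X.Nonempty}
    {S : Finset (Finset (Fin n))} (hS : S ⊆ X) (a b : X) (ha : a.1 ∉ S) (hb : b.1 ∉ S)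
    (hsep : ∀ c : Fin n → ℝ, ∑ i ∈ a.1, c i = ∑ i ∈ b.1, c i →
      ∃ s ∈ S, ∑ i ∈ a.1, c i ≤ ∑ i ∈ s, c i) :
    ¬ (polytopeOfSupports X hX).graph.Adj (supportsEquivVertex X hX a)
      (supportsEquivVertex X hX b) := by
  rintro ⟨-, hexp⟩
  rw [coe_supportsEquivVertex, coe_supportsEquivVertex] at hexp
  obtain ⟨l, hl⟩ := hexp ⟨_, left_mem_segment ℝ _ _⟩
  have hL := left_mem_segment ℝ (zeroOnePoint a.1) (zeroOnePoint b.1)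
  have hR := right_mem_segment ℝ (zeroOnePoint a.1) (zeroOnePoint b.1)
  rw [hl] at hL hR
  have heq := le_antisymm (hR.2 _ hL.1) (hL.2 _ hR.1)
  rw [clm_zeroOnePoint, clm_zeroOnePoint] at heq
  obtain ⟨s, hs, hle⟩ := hsep (fun i => l (Pi.single i 1)) heq
  rw [← clm_zeroOnePoint, ← clm_zeroOnePoint] at hle
  have hsQ : zeroOnePoint s ∈ (polytopeOfSupports X hX).toSet :=
    subset_convexHull ℝ _ (by simpa [polytopeOfSupports, zeroOnePoint_injective.eq_iff] using hS hs)
  have hseg : zeroOnePoint s ∈ segment ℝ (zeroOnePoint a.1) (zeroOnePoint b.1) := by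
    rw [hl]
    exact ⟨hsQ, fun y hy => (hL.2 y hy).trans hle⟩
  rcases eq_or_eq_of_zeroOnePoint_mem_segment hseg with h | h
  · exact ha (h ▸ hs)
  · exact hb (h ▸ hs)

theorem card_filter_supportsEquivVertex_symm {n : ℕ} {X : Finset (Finset (Fin n))}
    (hX : X.Nonempty) {Y : Finset (Finset (Fin n))} (hY : Y ⊆ X) :
    (Finset.univ.filter fun v : (polytopeOfSupports X hX).Vertex =>
      ((supportsEquivVertex X hX).symm v).1 ∈ Y).card = Y.card := by
  refine Finset.card_bij (fun v _ => ((supportsEquivVertex X hX).symm v).1) ?_ ?_ ?_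
  · intro v hv
    exact (Finset.mem_filter.1 hv).2
  · intro u _ v _ h
    exact (supportsEquivVertex X hX).symm.injective (Subtype.ext h)
  · intro y hy
    exact ⟨supportsEquivVertex X hX ⟨y, hY hy⟩, by simp [hy], by simp⟩

/-! ### The polytope with a small cut -/

/-- The convex hull of the `j`-sets, their complements and `O(n ^ 2)` separating points, with the
resulting bound on the time needed by reversible chains with uniform stationary distribution. -/
theorem exists_polytope_with_small_cut (n j : ℕ) :
    ∃ Q : ZeroOnePolytope n, 2 * j < n → ∃ σ α β : ℕ,
      σ ≤ 2 ^ (2 * j + 1) * (8 * (n + 1) ^ 2) ∧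
      n.choose j ≤ α + σ ∧ n.choose j ≤ β + σ ∧
      n.choose j ≤ Fintype.card Q.Vertex ∧ Fintype.card Q.Vertex ≤ 2 * n.choose j + σ ∧
      (0 < α → ∀ (P : Matrix Q.Vertex Q.Vertex ℝ),
        IsReversibleChainOn Q.graph (uniformDist Q.Vertex) P → ∀ (ε x : ℝ),
        (∀ t : ℕ, ((β : ℝ) / Fintype.card Q.Vertex - ε) * α ≤ t * σ → x ≤ t) →
          ENNReal.ofReal x ≤ (mixingTime P (uniformDist Q.Vertex) ε : ℝ≥0∞)) := by
  classical
  obtain ⟨S, hSne, hScard, hS⟩ := exists_separating_points n j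
  let A := Finset.powersetCard j (Finset.univ : Finset (Fin n))
  let B := A.image compl
  have hAcard : A.card = n.choose j := by simp [A]
  have hBcard : B.card = n.choose j := by
    rw [← hAcard]; exact Finset.card_image_of_injective _ compl_injective
  let X := A ∪ B ∪ S
  have hX : X.Nonempty := hSne.mono Finset.subset_union_right
  have hAX : A ⊆ X := Finset.subset_union_left.trans Finset.subset_union_left
  have hBX : B ⊆ X := Finset.subset_union_right.trans Finset.subset_union_left
  have hSX : S ⊆ X := Finset.subset_union_right
  have hVcard : Fintype.card (polytopeOfSupports X hX).Vertex = X.card := by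
    rw [← Fintype.card_congr (supportsEquivVertex X hX), Fintype.card_coe]
  refine ⟨polytopeOfSupports X hX, fun hn =>
    ⟨S.card, (A \ S).card, (B \ S).card, hScard, ?_, ?_, ?_, ?_, ?_⟩⟩
  · rw [← hAcard]; exact Finset.card_le_card_sdiff_add_card
  · rw [← hBcard]; exact Finset.card_le_card_sdiff_add_card
  · rw [hVcard, ← hAcard]; exact Finset.card_le_card hAX
  · rw [hVcard, two_mul]
    refine (Finset.card_union_le _ _).trans (Nat.add_le_add_right ?_ _)
    refine (Finset.card_union_le _ _).trans ?_
    rw [hAcard, hBcard]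
  · intro hα P hP ε x hx
    refine ofReal_le_mixingTime fun t ht => hx t ?_
    let V := (polytopeOfSupports X hX).Vertex
    let e : V → X := (supportsEquivVertex X hX).symm
    let inV : Finset (Finset (Fin n)) → Finset V := fun Y => Finset.univ.filter fun v => (e v).1 ∈ Y
    have hinV : ∀ Y, Y ⊆ X → (inV Y).card = Y.card := fun Y hY =>
      card_filter_supportsEquivVertex_symm hX hY
    have hmem : ∀ (Y : Finset (Finset (Fin n))) (v : V), v ∈ inV Y ↔ (e v).1 ∈ Y := by simp [inV]
    have hVpos : (0 : ℝ) < Fintype.card V := by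
      rw [hVcard]; exact_mod_cast hX.card_pos
    have hsymm : ∀ u v, P u v = P v u := fun u v => by
      have h := hP.reversible u v
      simp only [uniformDist] at h
      exact mul_left_cancel₀ (one_div_ne_zero hVpos.ne') h
    have hABdisj : ∀ a ∈ A, a ∉ B := by
      intro a ha hb
      obtain ⟨b, hb', rfl⟩ := Finset.mem_image.1 hb
      have h1 := (Finset.mem_powersetCard.1 ha).2
      have h2 := (Finset.mem_powersetCard.1 hb').2
      rw [Finset.card_compl, Fintype.card_fin] at h1
      omega
    rw [← hinV _ (Finset.sdiff_subset.trans hAX), ← hinV _ (Finset.sdiff_subset.trans hBX),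
      ← hinV _ hSX]
    refine mul_card_le_of_tvDist_le hP.nonneg hP.row_sum hsymm ?_ ?_ ?_ ht
    · rw [← Finset.card_pos, hinV _ (Finset.sdiff_subset.trans hAX)]
      exact hα
    · rw [Finset.disjoint_left]
      intro v hv hv'
      rw [hmem, Finset.mem_sdiff] at hv hv'
      exact hABdisj _ hv.1 hv'.1
    · intro u v huS huB hv
      rw [hmem] at huS huB hv
      rw [Finset.mem_sdiff] at hv huB
      -- A vertex outside `S` and outside `B \ S` must be a `j`-set.
      have huB' : (e u).1 ∉ B := fun h => huB ⟨h, huS⟩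
      have huA : (e u).1 ∈ A := by
        have h := (e u).2
        simp only [X, Finset.mem_union] at h
        tauto
      refine hP.supported u v (fun h => huB' (h ▸ hv.1)) ?_
      have hadj := not_adj_of_separating (hX := hX) hSX (e u) (e v) huS hv.2 ?_
      · simpa only [e, Equiv.apply_symm_apply] using hadj
      · intro c hc
        obtain ⟨b, hb, hbv⟩ := Finset.mem_image.1 hv.1
        rw [← hbv] at hc
        exact hS _ _ (Finset.mem_powersetCard.1 huA).2 (Finset.mem_powersetCard.1 hb).2 c hc

/-! ### Asymptotics -/

theorem pow_le_mul_choose {n j : ℕ} (h : 2 * j < n) :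
    n ^ j ≤ 2 ^ j * j.factorial * n.choose j := by
  calc n ^ j ≤ (2 * (n + 1 - j)) ^ j := Nat.pow_le_pow_left (by omega) _
    _ = 2 ^ j * (n + 1 - j) ^ j := mul_pow _ _ _
    _ ≤ 2 ^ j * n.descFactorial j := Nat.mul_le_mul_left _ (n.pow_sub_le_descFactorial j)
    _ = _ := by rw [Nat.descFactorial_eq_factorial_mul_choose, mul_assoc]

/-- Raise to the power `2 / j ≤ 2 / k`; since `2 / k ≤ 1` and `D ≥ 1`, the constant stays at most
`D`. -/
theorem sq_le_mul_rpow {k : ℝ} (hk : 2 < k) {j n v D : ℕ} (hj : k ≤ j) (hn : 0 < n) (hD : 0 < D)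
    (h : n ^ j ≤ D * v) : (n : ℝ) ^ 2 ≤ D * (v : ℝ) ^ (2 / k) := by
  have hj0 : (0 : ℝ) < j := by linarith
  have hDv : (1 : ℝ) ≤ D * v := by
    exact_mod_cast (Nat.one_le_pow _ _ hn).trans h
  have h' : (n : ℝ) ^ j ≤ D * v := by exact_mod_cast h
  have hD1 : (1 : ℝ) ≤ D := by exact_mod_cast hD
  calc (n : ℝ) ^ 2 = ((n : ℝ) ^ j) ^ (2 / (j : ℝ)) := by
        rw [← Real.rpow_natCast (n : ℝ) j, ← Real.rpow_mul (Nat.cast_nonneg _),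
          mul_div_cancel₀ _ hj0.ne', ← Real.rpow_natCast]
        norm_num
    _ ≤ (D * v : ℝ) ^ (2 / (j : ℝ)) :=
        Real.rpow_le_rpow (by positivity) h' (by positivity)
    _ ≤ (D * v : ℝ) ^ (2 / k) :=
        Real.rpow_le_rpow_of_exponent_le hDv (div_le_div_of_nonneg_left (by norm_num) (by linarith) hj)
    _ = (D : ℝ) ^ (2 / k) * (v : ℝ) ^ (2 / k) :=
        Real.mul_rpow (Nat.cast_nonneg _) (Nat.cast_nonneg _)
    _ ≤ (D : ℝ) ^ (1 : ℝ) * (v : ℝ) ^ (2 / k) := by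
        refine mul_le_mul_of_nonneg_right (Real.rpow_le_rpow_of_exponent_le hD1 ?_) (by positivity)
        rw [div_le_one (by linarith)]; exact hk.le
    _ = _ := by rw [Real.rpow_one]

theorem mainTheorem6 (k : ℝ) (hk : 2 < k) :
    ∃ Q : (n : ℕ) → ZeroOnePolytope n,
      Filter.Tendsto (fun n => Fintype.card (Q n).Vertex) Filter.atTop Filter.atTop ∧
      ∀ ε : ℝ, 0 < ε → ε < 1 / 2 →
        ∃ c : ℝ, 0 < c ∧ ∀ᶠ n in Filter.atTop,
          ∀ P : Matrix (Q n).Vertex (Q n).Vertex ℝ,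
            IsReversibleChainOn (Q n).graph (uniformDist (Q n).Vertex) P →
              ENNReal.ofReal (c * (Fintype.card (Q n).Vertex : ℝ) ^ (1 - 2 / k)) ≤
                (mixingTime P (uniformDist (Q n).Vertex) ε : ℝ≥0∞) := by
  obtain ⟨j, hj⟩ := exists_nat_ge k
  have hj3 : 3 ≤ j := by
    have h : (2 : ℝ) < j := hk.trans_le hj
    exact_mod_cast h
  choose Q hQ using fun n => exists_polytope_with_small_cut n j
  let D := 2 ^ j * j.factorial
  let C := 2 ^ (2 * j + 1) * 32
  have hD : 0 < D := by positivity
  have hC : 0 < C := by positivity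
  have hpow : ∀ n, 2 * j < n → n ^ 3 ≤ D * n.choose j := fun n hn =>
    (Nat.pow_le_pow_right (by omega) hj3).trans (pow_le_mul_choose hn)
  refine ⟨Q, ?_, ?_⟩
  · rw [Filter.tendsto_atTop]
    intro b
    filter_upwards [Filter.eventually_gt_atTop (2 * j + D * b)] with n hn
    obtain ⟨σ, α, β, -, -, -, hV, -⟩ := hQ n (by omega)
    refine le_trans ?_ hV
    have h1 := hpow n (by omega)
    have h2 : n ≤ n ^ 3 := Nat.le_self_pow (by norm_num) n
    exact Nat.le_of_mul_le_mul_left (show D * b ≤ D * n.choose j by omega) hD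
  · intro ε hε hε2
    -- Half the gap `1 / 2 - ε`: part `B` keeps stationary mass at least `1 / 2 - η = ε + η`.
    set η : ℝ := (1 / 2 - ε) / 2 with hη
    have hη0 : 0 < η := by rw [hη]; linarith
    have hη1 : η < 1 / 4 := by rw [hη]; linarith
    have hDr : (0 : ℝ) < D := by exact_mod_cast hD
    have hCr : (0 : ℝ) < C := by exact_mod_cast hC
    refine ⟨η / (6 * C * D), by positivity, ?_⟩
    filter_upwards [Filter.eventually_gt_atTop (2 * j),
      Filter.eventually_ge_atTop ⌈(C * D : ℝ) / η⌉₊] with n hn hnlarge P hP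
    obtain ⟨σ, α, β, hσ, hα, hβ, hV, hV', hmix⟩ := hQ n hn
    have hσC : (σ : ℝ) ≤ C * n ^ 2 := by
      have : σ ≤ C * n ^ 2 := by
        refine hσ.trans ?_
        simp only [C]
        rw [mul_assoc]
        exact Nat.mul_le_mul_left _ (by nlinarith)
      exact_mod_cast this
    set N : ℝ := (n.choose j : ℝ) with hN
    set v : ℝ := (Fintype.card (Q n).Vertex : ℝ) with hv
    have hn0 : (0 : ℝ) < n := by exact_mod_cast (by omega : 0 < n)
    have hnl : (C * D : ℝ) ≤ η * n := by
      have := (Nat.le_ceil _).trans (Nat.cast_le (α := ℝ).2 hnlarge)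
      rwa [div_le_iff₀ hη0, mul_comm (n : ℝ)] at this
    have hN3 : (n : ℝ) ^ 3 ≤ D * N := by rw [hN]; exact_mod_cast hpow n hn
    have hN0 : 0 < N := by
      have : (0 : ℝ) < D * N := lt_of_lt_of_le (by positivity) hN3
      exact pos_of_mul_pos_right this hDr.le
    -- Here `j ≥ 3` is needed: the cut, of order `n ^ 2`, is negligible against `n.choose j`.
    have hσN : (σ : ℝ) ≤ η * N := by
      have h1 : (D : ℝ) * σ ≤ D * (η * N) := by
        calc (D : ℝ) * σ ≤ D * (C * n ^ 2) := mul_le_mul_of_nonneg_left hσC hDr.le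
          _ = (C * D) * n ^ 2 := by ring
          _ ≤ (η * n) * n ^ 2 := mul_le_mul_of_nonneg_right hnl (by positivity)
          _ = η * n ^ 3 := by ring
          _ ≤ η * (D * N) := mul_le_mul_of_nonneg_left hN3 hη0.le
          _ = _ := by ring
      exact le_of_mul_le_mul_left h1 hDr
    have hαN : N ≤ α + σ := by rw [hN]; exact_mod_cast hα
    have hβN : N ≤ β + σ := by rw [hN]; exact_mod_cast hβ
    have hvN : N ≤ v := by rw [hN, hv]; exact_mod_cast hV
    have hvN' : v ≤ 2 * N + σ := by rw [hN, hv]; exact_mod_cast hV'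
    have hηN : η * N ≤ 1 / 4 * N := mul_le_mul_of_nonneg_right hη1.le hN0.le
    have hv0 : 0 < v := hN0.trans_le hvN
    have hα0 : (0 : ℝ) < α := by linarith
    refine hmix (by exact_mod_cast hα0) P hP ε _ fun t ht => ?_
    have hβv : ε + η ≤ β / v := by
      rw [le_div_iff₀ hv0]
      have h1 : ε + η = 1 / 2 - η := by rw [hη]; ring
      rw [h1]
      have h2 : (1 / 2 - η) * v ≤ (1 / 2 - η) * ((2 + η) * N) :=
        mul_le_mul_of_nonneg_left (by linarith) (by linarith)
      have h3 : (1 / 2 - η) * ((2 + η) * N) ≤ (1 - η) * N := by nlinarith [mul_pos hη0 hN0]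
      linarith
    have hsq := sq_le_mul_rpow hk hj (by omega) hD
      ((pow_le_mul_choose hn).trans (Nat.mul_le_mul_left _ hV))
    have hmain : η * (v / 6) ≤ t * (C * (D * v ^ (2 / k))) := by
      calc η * (v / 6) ≤ η * α := mul_le_mul_of_nonneg_left (by linarith) hη0.le
        _ ≤ (β / v - ε) * α := mul_le_mul_of_nonneg_right (by linarith) hα0.le
        _ ≤ t * σ := ht
        _ ≤ t * (C * (D * v ^ (2 / k))) := by
            refine mul_le_mul_of_nonneg_left (hσC.trans ?_) (Nat.cast_nonneg _)
            exact mul_le_mul_of_nonneg_left hsq hCr.le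
    rw [Real.rpow_sub hv0, Real.rpow_one]
    have hvk : 0 < v ^ (2 / k) := Real.rpow_pos_of_pos hv0 _
    rw [div_mul_div_comm, div_le_iff₀ (by positivity)]
    linarith
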